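/- Let $(R,\mathfrak m)$ be a Noetherian local ring of prime characteristic $p>0$ and Krull dimension $d$ that is equidimensional, i.e. $\dim R/P=\dim R$ for every minimal prime $P$ of $R$, and assume that $R$ is a homomorphic image of a Cohen–Macaulay ring. Let $I$ be a parameter ideal of $R$, i.e. an ideal generated by $d$ elements with $\sqrt I=\mathfrak m$. For $q=p^e$ ($e\ge 0$) let $I^{[q]}$ be the ideal generated by the elements $i^q$, $i\in I$, and for an ideal $J$ let its tight closure $J^*$ be the ideal of all $x\in R$ for which there is an element $c$ outside every minimal prime of $R$ with $c\,x^{q}\in J^{[q]}$ for all sufficiently large $q=p^e$. Let $\lambda$ denote length of $R$-modules. Then $$\lambda\big(R/(I^{[p]})^*\big)\ \ge\ p^d\,\lambda(R/I^*).$$ Moreover, for every $e\ge 0$ the length $\lambda\big(R/(I^{[p^e]})^*\big)$ is finite, and the sequence $$a_e=\frac{\lambda\big(R/(I^{[p^e]})^*\big)}{(p^e)^d}\qquad(e\ge 0)$$ is non-decreasing: $a_e\le a_{e'}$ whenever $e\le e'$. -/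

import Mathlib

namespace TightClosureIneq

/-- The depth of a local ring: the supremum of the lengths of regular sequences contained in the
maximal ideal. -/
noncomputable def localDepth (A : Type*) [CommRing A] [IsLocalRing A] : ℕ∞ :=
  ⨆ (rs : List A) (_ : ∀ r ∈ rs, r ∈ IsLocalRing.maximalIdeal A)
    (_ : RingTheory.Sequence.IsRegular A rs), (rs.length : ℕ∞)

/-- A commutative ring is Cohen-Macaulay if it is Noetherian and all its localizations at maximal
ideals have depth equal to their Krull dimension. -/
structure IsCohenMacaulayRing (A : Type*) [CommRing A] : Prop where
  isNoetherianRing : IsNoetherianRing A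
  depth_eq_dim : ∀ (P : Ideal A) [P.IsMaximal],
    ((localDepth (Localization.AtPrime P) : ℕ∞) : WithBot ℕ∞) =
      ringKrullDim (Localization.AtPrime P)

/-- A ring is equidimensional if `dim R/P = dim R` for every minimal prime `P`. -/
def IsEquidimensional (R : Type*) [CommRing R] : Prop :=
  ∀ P ∈ minimalPrimes R, ringKrullDim (R ⧸ P) = ringKrullDim R

/-- A parameter ideal of a local ring: an ideal generated by `d = dim R` elements whose radical is
the maximal ideal. -/
def IsParameterIdeal {R : Type*} [CommRing R] [IsLocalRing R] (I : Ideal R) : Prop :=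
  ∃ (d : ℕ) (x : Fin d → R), ringKrullDim R = d ∧ I = Ideal.span (Set.range x) ∧
    I.radical = IsLocalRing.maximalIdeal R

/-- The ideal `I^{[q]}` generated by the `q`-th powers of all the elements of `I`. -/
def frobeniusPower {R : Type*} [CommRing R] (I : Ideal R) (q : ℕ) : Ideal R :=
  Ideal.span {y | ∃ i ∈ I, y = i ^ q}

/-- The complement `R°` of the union of the minimal primes of `R`. -/
def minimalPrimesCompl (R : Type*) [CommRing R] : Set R :=
  {c | ∀ P ∈ minimalPrimes R, c ∉ P}

/-- The tight closure `I^*` of an ideal `I` of a ring of prime characteristic `p`: the `x` for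
which some `c ∈ R°` satisfies `c x^q ∈ I^{[q]}` for all sufficiently large powers `q = p^e`. -/
def tightClosure {R : Type*} [CommRing R] (p : ℕ) [Fact p.Prime] [CharP R p] (I : Ideal R) :
    Ideal R where
  carrier := {x | ∃ c ∈ minimalPrimesCompl R, ∃ N : ℕ, ∀ e ≥ N,
    c * x ^ p ^ e ∈ frobeniusPower I (p ^ e)}
  zero_mem' := by
    refine ⟨1, fun P hP h => hP.1.1.ne_top ((Ideal.eq_top_iff_one P).2 h), 0, fun e _ => ?_⟩
    rw [zero_pow (pow_ne_zero _ (Fact.out : p.Prime).ne_zero), mul_zero]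
    exact zero_mem _
  add_mem' := by
    rintro x y ⟨c, hc, N, hx⟩ ⟨c', hc', N', hy⟩
    refine ⟨c * c', fun P hP h => (hP.1.1.mem_or_mem h).elim (hc P hP) (hc' P hP),
      max N N', fun e he => ?_⟩
    have h1 := Ideal.mul_mem_left _ c' (hx e (le_trans (le_max_left _ _) he))
    have h2 := Ideal.mul_mem_left _ c (hy e (le_trans (le_max_right _ _) he))
    rw [add_pow_char_pow]
    convert add_mem h1 h2 using 1
    ring
  smul_mem' := by
    rintro r x ⟨c, hc, N, hx⟩
    refine ⟨c, hc, N, fun e he => ?_⟩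
    convert Ideal.mul_mem_left _ (r ^ p ^ e) (hx e he) using 1
    rw [smul_eq_mul, mul_pow]
    ring

end TightClosureIneq

/-!
Let `I = (x_1, …, x_d)`. The monomials `x^a` with all exponents below `p`, adjoined to
`(I^{[p]})^*` in decreasing lexicographic order, filter `R ⧸ (I^{[p]})^*` with `p ^ d` cyclic
quotients `R ⧸ (L_a : x^a)`. Here `L_a` is contained in `(I^{[p]})^* + (x_1^{a_1+1}, …, x_d^{a_d+1})`
because a lexicographically larger monomial exceeds `x^a` in some exponent. So the inequality
follows once `L_a : x^a ⊆ I^*` (`mem_tightClosure_of_mul_prod_mem`). After raising to the `q`-th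
power this asks for one element `c`, outside all minimal primes, that multiplies
`(x^{t + n}) : x^n` into `(x^t)` for all exponents at once. Dealing with one variable at a time, it
is enough that `c` multiplies `(x_j^{t_j} : j ≠ i) : x_i^{t_i}` into `(x_j^{t_j} : j ≠ i)`
(`exists_colon_killer`). Applied to the ideals `I^{[p^e]}`, the inequality is the monotonicity.

To find `c`, localize the given Cohen-Macaulay ring and divide by regular elements of the kernel
until `R = B ⧸ Q` with `B` Cohen-Macaulay local of dimension `d`
(`exists_cohenMacaulay_of_ringKrullDim_eq`). As `R` is equidimensional, its minimal primes are
minimal in `B`. The `x_i` lift to a system of parameters `y` of `B` (`exists_lift_parameters`),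
whose powers are regular sequences, so that the ideals they generate have bounded projective
dimension. The obstruction to the colon property is then a `Tor₁^B(-, B ⧸ Q)`. Such modules have a
common annihilator outside all minimal primes of `B` (`exists_killsTorOne`): a prime filtration
reduces the claim to modules `B ⧸ P`, and for `P` minimal an embedding of `B ⧸ P` into `B` allows
dimension shifting, which stops because the projective dimensions are bounded. This argument does
not use the characteristic of `B`, which may be mixed.
-/

namespace TightClosureIneq

universe u v

open TensorProduct CategoryTheory IsLocalRing RingTheory.Sequence Module Pointwise

/-! ### Uniform annihilation of Tor -/

lemma one_mem_minimalPrimesCompl (R : Type*) [CommRing R] : (1 : R) ∈ minimalPrimesCompl R :=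
  fun P hP h => hP.1.1.ne_top ((Ideal.eq_top_iff_one P).2 h)

lemma mul_mem_minimalPrimesCompl {R : Type*} [CommRing R] {a b : R}
    (ha : a ∈ minimalPrimesCompl R) (hb : b ∈ minimalPrimesCompl R) :
    a * b ∈ minimalPrimesCompl R :=
  fun P hP h => (hP.1.1.mem_or_mem h).elim (ha P hP) (hb P hP)

lemma pow_mem_minimalPrimesCompl {R : Type*} [CommRing R] {a : R}
    (ha : a ∈ minimalPrimesCompl R) (n : ℕ) : a ^ n ∈ minimalPrimesCompl R :=
  fun P hP h => ha P hP (hP.1.1.mem_of_pow_mem n h)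

lemma exists_mem_minimalPrimesCompl_of_notMem {B : Type*} [CommRing B] [IsNoetherianRing B]
    (p : Ideal B) [p.IsPrime] (hp : p ∉ minimalPrimes B) : ∃ c ∈ p, c ∈ minimalPrimesCompl B := by
  by_contra! h
  have hfin : (minimalPrimes B).Finite := minimalPrimes.finite_of_isNoetherianRing B
  have hsub : (p : Set B) ⊆ ⋃ q ∈ minimalPrimes B, (id q : Ideal B) := by
    intro c hc
    have := h c hc
    simp only [minimalPrimesCompl, Set.mem_ofPred_eq, not_forall, not_not] at this
    obtain ⟨q, hq, hcq⟩ := this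
    exact Set.mem_biUnion hq hcq
  obtain ⟨q, hq, hpq⟩ := (Ideal.subset_union_prime_finite hfin ⊥ ⊥
    (fun q hq _ _ => hq.1.1)).1 hsub
  have : p = q := le_antisymm hpq (hq.2 ⟨inferInstance, bot_le⟩ hpq)
  exact hp (this ▸ hq)

/-- A module of projective dimension at most `n` is the quotient of a flat module by a submodule of
projective dimension at most `n - 1`; when `n = 0` the module itself serves as its cover. -/
lemma exists_flat_cover {B : Type v} [CommRing B] (n : ℕ) (K : Type v) [AddCommGroup K] [Module B K]
    (hK : HasProjectiveDimensionLT (ModuleCat.of B K) (n + 1)) :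
    ∃ (F : ModuleCat.{v} B) (π : F →ₗ[B] K), Module.Flat B F ∧ Function.Surjective π ∧
      HasProjectiveDimensionLT (ModuleCat.of B (LinearMap.ker π)) n := by
  cases n with
  | zero =>
    have : Projective (ModuleCat.of B K) := projective_iff_hasProjectiveDimensionLT_one.2 hK
    have : Module.Projective B K := (IsProjective.iff_projective K).2 this
    refine ⟨ModuleCat.of B K, LinearMap.id, inferInstance, Function.surjective_id, ?_⟩
    rw [hasProjectiveDimensionLT_zero_iff_isZero, ModuleCat.isZero_iff_subsingleton]
    simp only [LinearMap.ker_id]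
    infer_instance
  | succ n =>
    have hsurj : Function.Surjective (Finsupp.linearCombination B (id : K → K)) :=
      Finsupp.linearCombination_id_surjective B K
    refine ⟨ModuleCat.of B (K →₀ B), Finsupp.linearCombination B id, inferInstance, hsurj, ?_⟩
    have hS := LinearMap.shortExact_shortComplexKer hsurj
    have hproj : Projective (ModuleCat.of B (K →₀ B)) :=
      (IsProjective.iff_projective (K →₀ B)).1 inferInstance
    exact (hS.hasProjectiveDimensionLT_X₃_iff n hproj).1 hK

/-- `c` annihilates `Tor₁(F / K, M)` for every flat module `F` and every submodule `K` of
projective dimension less than `n`; this `Tor` is the kernel of `K ⊗ M → F ⊗ M`. -/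
def KillsTorOne (B : Type v) [CommRing B] (n : ℕ) (M : Type v) [AddCommGroup M] [Module B M]
    (c : B) : Prop :=
  ∀ (K F : Type v) [AddCommGroup K] [AddCommGroup F] [Module B K] [Module B F] [Module.Flat B F]
    (ι : K →ₗ[B] F), Function.Injective ι → HasProjectiveDimensionLT (ModuleCat.of B K) n →
    ∀ z : K ⊗[B] M, ι.rTensor M z = 0 → c • z = 0

lemma KillsTorOne.mul_of_exact {B : Type v} [CommRing B] {n : ℕ} {N₁ N₂ N₃ : Type v}
    [AddCommGroup N₁] [AddCommGroup N₂] [AddCommGroup N₃] [Module B N₁] [Module B N₂] [Module B N₃]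
    {f : N₁ →ₗ[B] N₂} {g : N₂ →ₗ[B] N₃} (hf : Function.Injective f) (hg : Function.Surjective g)
    (hfg : Function.Exact f g) {c₁ c₃ : B} (h₁ : KillsTorOne B n N₁ c₁)
    (h₃ : KillsTorOne B n N₃ c₃) : KillsTorOne B n N₂ (c₁ * c₃) := by
  intro K F _ _ _ _ _ ι hι hK z hz
  have h3 : c₃ • g.lTensor K z = 0 := by
    refine h₃ K F ι hι hK _ ?_
    rw [← LinearMap.comp_apply, LinearMap.rTensor_comp_lTensor, ← LinearMap.lTensor_comp_rTensor,
      LinearMap.comp_apply, hz, map_zero]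
  rw [← map_smul] at h3
  obtain ⟨w, hw⟩ := (lTensor_exact K hfg hg _).1 h3
  have hw0 : ι.rTensor N₁ w = 0 := by
    apply Module.Flat.lTensor_preserves_injective_linearMap (M := F) f hf
    rw [← LinearMap.comp_apply, LinearMap.lTensor_comp_rTensor, ← LinearMap.rTensor_comp_lTensor,
      LinearMap.comp_apply, hw, map_smul, hz, smul_zero, map_zero]
  rw [mul_smul, ← hw, ← map_smul, h₁ K F ι hι hK w hw0, map_zero]

/-- Dimension shifting along `0 → N → B → C → 0`: since `Tor` of `B` vanishes in positive degrees,
`Tor₁(-, N)` is `Tor₂(-, C)`, that is, `Tor₁` of a syzygy with values in `C`. -/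
lemma KillsTorOne.of_exact_ring {B : Type v} [CommRing B] {n : ℕ} {N C : Type v}
    [AddCommGroup N] [AddCommGroup C] [Module B N] [Module B C]
    {j : N →ₗ[B] B} {g : B →ₗ[B] C} (hj : Function.Injective j) (hg : Function.Surjective g)
    (hjg : Function.Exact j g) {c : B} (hc : KillsTorOne B n C c) :
    KillsTorOne B (n + 1) N c := by
  intro K F _ _ _ _ _ ι hι hK z hz
  obtain ⟨F', π, hF', hπ, hK'⟩ := exists_flat_cover n K hK
  have hB : Function.Injective (ι.rTensor B) := by
    have : ι.rTensor B = (TensorProduct.rid B F).symm ∘ₗ ι ∘ₗ (TensorProduct.rid B K) := by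
      ext; simp
    rw [this]
    exact (TensorProduct.rid B F).symm.injective.comp
      (hι.comp (TensorProduct.rid B K).injective)
  -- the image of `z` in `K ⊗ B` vanishes, as `K ⊗ B → F ⊗ B` is injective
  have hz' : j.lTensor K z = 0 := by
    apply hB
    rw [← LinearMap.comp_apply, LinearMap.rTensor_comp_lTensor, ← LinearMap.lTensor_comp_rTensor,
      LinearMap.comp_apply, hz, map_zero, map_zero]
  obtain ⟨z₁, rfl⟩ := LinearMap.rTensor_surjective N hπ z
  have hex : Function.Exact (LinearMap.ker π).subtype π := LinearMap.exact_subtype_ker_map π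
  have h1 : π.rTensor B (j.lTensor F' z₁) = 0 := by
    rw [← LinearMap.comp_apply, LinearMap.rTensor_comp_lTensor, ← LinearMap.lTensor_comp_rTensor,
      LinearMap.comp_apply, hz']
  obtain ⟨k, hk⟩ := (rTensor_exact B hex hπ _).1 h1
  have h2 : c • g.lTensor _ k = 0 := by
    refine hc _ F' (LinearMap.ker π).subtype (Submodule.subtype_injective _) hK' _ ?_
    rw [← LinearMap.comp_apply, LinearMap.rTensor_comp_lTensor, ← LinearMap.lTensor_comp_rTensor,
      LinearMap.comp_apply, hk, ← LinearMap.comp_apply, ← LinearMap.lTensor_comp,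
      hjg.linearMap_comp_eq_zero, LinearMap.lTensor_zero, LinearMap.zero_apply]
  rw [← map_smul] at h2
  obtain ⟨k', hk'⟩ := (lTensor_exact _ hjg hg _).1 h2
  have h3 : (LinearMap.ker π).subtype.rTensor N k' = c • z₁ := by
    apply Module.Flat.lTensor_preserves_injective_linearMap (M := F') j hj
    rw [← LinearMap.comp_apply, LinearMap.lTensor_comp_rTensor, ← LinearMap.rTensor_comp_lTensor,
      LinearMap.comp_apply, hk', map_smul, hk, map_smul]
  rw [← map_smul, ← h3, ← LinearMap.comp_apply, ← LinearMap.rTensor_comp,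
    hex.linearMap_comp_eq_zero, LinearMap.rTensor_zero, LinearMap.zero_apply]

/-- For each finite module `M` over a Noetherian ring and each bound on the projective dimension,
one element outside all minimal primes annihilates all the `Tor₁` with values in `M`. A prime
filtration reduces to `M = B ⧸ p`. If `p` is not minimal, an element of `p` does; if `p` is
minimal, then `p` is associated, so `B ⧸ p` embeds into `B` and dimension shifting applies. -/
theorem exists_killsTorOne (B : Type v) [CommRing B] [IsNoetherianRing B] (n : ℕ) (M : Type v)
    [AddCommGroup M] [Module B M] [hM : Module.Finite B M] :
    ∃ c ∈ minimalPrimesCompl B, KillsTorOne B n M c := by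
  induction n generalizing M with
  | zero =>
    refine ⟨1, one_mem_minimalPrimesCompl B, ?_⟩
    intro K F _ _ _ _ _ ι _ hK z _
    rw [hasProjectiveDimensionLT_zero_iff_isZero, ModuleCat.isZero_iff_subsingleton] at hK
    have : Subsingleton K := hK
    exact Subsingleton.elim _ _
  | succ n ih =>
    induction hM using IsNoetherianRing.induction_on_isQuotientEquivQuotientPrime B with
    | subsingleton N =>
      exact ⟨1, one_mem_minimalPrimesCompl B, fun K F _ _ _ _ _ ι _ _ z _ =>
        Subsingleton.elim _ _⟩
    | quotient N p e =>
      by_cases hp : p.1 ∈ minimalPrimes B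
      · have hass : p.1 ∈ associatedPrimes B B := by
          apply Module.associatedPrimes.minimalPrimes_annihilator_subset_associatedPrimes
          rwa [Module.annihilator_eq_bot.2 inferInstance]
        obtain ⟨b, hb⟩ := (isAssociatedPrime_iff.1 hass).2
        have hmem : ∀ r : B, r ∈ p.1 ↔ r * b = 0 := fun r => by
          rw [hb, Submodule.mem_colon_singleton, Submodule.mem_bot, smul_eq_mul]
        let φ : (B ⧸ p.1) →ₗ[B] B := Submodule.liftQ p.1 (LinearMap.toSpanSingleton B B b)
          fun r hr => by simpa using (hmem r).1 hr
        have hφ : Function.Injective φ := by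
          rw [← LinearMap.ker_eq_bot]
          refine Submodule.ker_liftQ_eq_bot _ _ _ fun r hr => (hmem r).2 (by simpa using hr)
        have hj : Function.Injective (φ ∘ₗ e.toLinearMap) := hφ.comp e.injective
        obtain ⟨c, hc, hc'⟩ := ih (B ⧸ LinearMap.range (φ ∘ₗ e.toLinearMap))
        exact ⟨c, hc, hc'.of_exact_ring hj (Submodule.mkQ_surjective _)
          (LinearMap.exact_map_mkQ_range _)⟩
      · obtain ⟨c, hcp, hc⟩ := exists_mem_minimalPrimesCompl_of_notMem p.1 hp
        refine ⟨c, hc, ?_⟩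
        intro K _ _ _ _ _ _ _ _ _ z _
        have hcN : ∀ x : N, c • x = 0 := fun x => by
          apply e.injective
          obtain ⟨b, hb⟩ := Ideal.Quotient.mk_surjective (e x)
          rw [map_smul, map_zero, ← hb, ← Ideal.Quotient.mk_eq_mk, ← Submodule.Quotient.mk_smul,
            Submodule.Quotient.mk_eq_zero]
          exact Ideal.mul_mem_right _ _ hcp
        have h0 : c • (LinearMap.id : N →ₗ[B] N) = 0 := LinearMap.ext hcN
        have h1 := congrArg (fun g => LinearMap.lTensor K g z) h0
        simpa using h1
    | exact N₁ N₂ N₃ f g hf hg hfg h₁ h₃ =>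
      obtain ⟨c₁, hc₁, h₁⟩ := h₁
      obtain ⟨c₃, hc₃, h₃⟩ := h₃
      exact ⟨c₁ * c₃, mul_mem_minimalPrimesCompl hc₁ hc₃, h₁.mul_of_exact hf hg hfg h₃⟩

/-! ### Depth and systems of parameters -/

lemma ringKrullDim_quotient_le_of_le {R : Type*} [CommRing R] {p q : Ideal R} (h : p ≤ q) :
    ringKrullDim (R ⧸ q) ≤ ringKrullDim (R ⧸ p) :=
  ringKrullDim_le_of_surjective (Ideal.Quotient.factor h) (Ideal.Quotient.factor_surjective h)

lemma ringKrullDim_quotient_succ_le_of_lt {R : Type*} [CommRing R] {p q : Ideal R} [p.IsPrime]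
    (h : p < q) : ringKrullDim (R ⧸ q) + 1 ≤ ringKrullDim (R ⧸ p) := by
  obtain ⟨r, hrq, hrp⟩ := SetLike.exists_of_lt h
  refine ringKrullDim_succ_le_of_surjective (Ideal.Quotient.factor h.le)
    (Ideal.Quotient.factor_surjective h.le) (r := Ideal.Quotient.mk p r) ?_ ?_
  · rw [mem_nonZeroDivisors_iff_ne_zero]
    rwa [Ne, Ideal.Quotient.eq_zero_iff_mem]
  · rw [Ideal.Quotient.factor_mk]
    exact Ideal.Quotient.eq_zero_iff_mem.2 hrq

/-- An associated prime `p` of `M` lies strictly below an associated prime of `M ⧸ a M` when `a` is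
regular: by Nakayama, some element of `M` killed by `p` survives in `M ⧸ a M`. -/
lemma exists_associatedPrimes_quotSMulTop_gt {R : Type*} [CommRing R] [IsLocalRing R]
    [IsNoetherianRing R] {M : Type*} [AddCommGroup M] [Module R M] [Module.Finite R M] {a : R}
    (ha : a ∈ maximalIdeal R) (hreg : IsSMulRegular M a) {p : Ideal R}
    (hp : p ∈ associatedPrimes R M) : ∃ q ∈ associatedPrimes R (QuotSMulTop a M), p < q := by
  obtain ⟨hpp, x, hx⟩ := isAssociatedPrime_iff.1 hp
  have hmem : ∀ r : R, r ∈ p ↔ r • x = 0 := fun r => by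
    rw [hx, Submodule.mem_colon_singleton, Submodule.mem_bot]
  have hx0 : x ≠ 0 := fun h => hpp.ne_top ((Ideal.eq_top_iff_one p).2 ((hmem 1).2 (by simp [h])))
  let U : Submodule R M := Submodule.torsionBySet R M (p : Set R)
  have hU : ∀ u, u ∈ U ↔ ∀ r ∈ p, r • u = 0 := fun u => by
    simp [U, Submodule.mem_torsionBySet_iff]
  have hxU : x ∈ U := (hU x).2 fun r hr => (hmem r).1 hr
  have hnot : ¬ U ≤ a • (⊤ : Submodule R M) := by
    intro hle
    have h1 : U ≤ Ideal.span {a} • U := by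
      intro u hu
      obtain ⟨v, -, rfl⟩ := (Submodule.mem_smul_pointwise_iff_exists _ _ _).1 (hle hu)
      refine Submodule.smul_mem_smul (Ideal.mem_span_singleton_self a) ((hU v).2 fun r hr => ?_)
      apply hreg
      have := (hU _).1 hu r hr
      simpa [smul_comm a r v] using this
    have h2 := Submodule.eq_bot_of_le_smul_of_le_jacobson_bot _ U (IsNoetherian.noetherian U) h1
      (by
        rw [IsLocalRing.jacobson_eq_maximalIdeal ⊥ bot_ne_top]
        exact (Ideal.span_singleton_le_iff_mem _).2 ha)
    rw [h2] at hxU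
    exact hx0 hxU
  obtain ⟨u, hu, hua⟩ := SetLike.not_le_iff_exists.1 hnot
  have hu0 : (Submodule.Quotient.mk u : QuotSMulTop a M) ≠ 0 := fun h =>
    hua ((Submodule.Quotient.mk_eq_zero _).1 h)
  obtain ⟨q, hq, hle⟩ := exists_le_isAssociatedPrime_of_isNoetherianRing R _ hu0
  refine ⟨q, hq, lt_of_le_of_ne (fun r hr => hle ?_) ?_⟩
  · rw [Submodule.mem_colon_singleton, Submodule.mem_bot, ← Submodule.Quotient.mk_smul,
      (hU u).1 hu r hr, Submodule.Quotient.mk_zero]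
  · rintro rfl
    have haq : a ∈ p := hle <| by
      rw [Submodule.mem_colon_singleton, Submodule.mem_bot, ← Submodule.Quotient.mk_smul,
        Submodule.Quotient.mk_eq_zero]
      exact Submodule.smul_mem_pointwise_smul u a ⊤ trivial
    apply hx0
    apply hreg
    simpa using (hmem a).1 haq

lemma length_le_ringKrullDim_quotient_of_mem_associatedPrimes {R : Type*} [CommRing R]
    [IsLocalRing R] [IsNoetherianRing R] {M : Type*} [AddCommGroup M] [Module R M]
    [Module.Finite R M] {rs : List R} (hrs : IsRegular M rs) (hmem : ∀ r ∈ rs, r ∈ maximalIdeal R)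
    {p : Ideal R} (hp : p ∈ associatedPrimes R M) :
    (rs.length : WithBot ℕ∞) ≤ ringKrullDim (R ⧸ p) := by
  have hpp : p.IsPrime := IsAssociatedPrime.isPrime hp
  induction rs generalizing M p with
  | nil => simpa using ringKrullDim_nonneg_of_nontrivial
  | cons a rs ih =>
    obtain ⟨h1, h2⟩ := (isRegular_cons_iff M a rs).1 hrs
    obtain ⟨q, hq, hpq⟩ := exists_associatedPrimes_quotSMulTop_gt
      (hmem a List.mem_cons_self) h1 hp
    have h3 := ih h2 (fun r hr => hmem r (List.mem_cons_of_mem a hr)) hq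
      (IsAssociatedPrime.isPrime hq)
    calc ((a :: rs).length : WithBot ℕ∞) = rs.length + 1 := by simp
      _ ≤ ringKrullDim (R ⧸ q) + 1 := by gcongr
      _ ≤ _ := ringKrullDim_quotient_succ_le_of_lt hpq

/-- The `R`-module `M` has a regular sequence of length `n` inside the maximal ideal, that is, its
depth is at least `n`. -/
def HasRegularSequence (R M : Type*) [CommRing R] [IsLocalRing R] [AddCommGroup M] [Module R M]
    (n : ℕ) : Prop :=
  ∃ rs : List R, rs.length = n ∧ (∀ r ∈ rs, r ∈ maximalIdeal R) ∧ IsRegular M rs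

lemma HasRegularSequence.nontrivial {R M : Type*} [CommRing R] [IsLocalRing R] [AddCommGroup M]
    [Module R M] {n : ℕ} (h : HasRegularSequence R M n) : Nontrivial M := by
  obtain ⟨rs, -, -, hrs⟩ := h
  exact hrs.nontrivial

lemma maximalIdeal_smul_top_lt_top {R M : Type*} [CommRing R] [IsLocalRing R] [AddCommGroup M]
    [Module R M] [Module.Finite R M] [Nontrivial M] :
    maximalIdeal R • (⊤ : Submodule R M) < ⊤ :=
  lt_top_iff_ne_top.2 (Submodule.top_ne_ideal_smul_of_le_jacobson_annihilator
    (maximalIdeal_le_jacobson _)).symm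

/-- Dividing by any regular element, not only by the first term of the given sequence, lowers the
depth by at most one: by Rees' theorem depth is read off from the vanishing of `Ext`. -/
lemma HasRegularSequence.quotSMulTop {R M : Type v} [CommRing R] [IsLocalRing R]
    [IsNoetherianRing R] [AddCommGroup M] [Module R M] [Module.Finite R M] {n : ℕ}
    (h : HasRegularSequence R M (n + 1)) {z : R} (hz : z ∈ maximalIdeal R)
    (hreg : IsSMulRegular M z) : HasRegularSequence R (QuotSMulTop z M) n := by
  have := h.nontrivial
  have := nontrivial_quotSMulTop_of_mem_maximalIdeal M hz
  have h1 := ((ModuleCat.exists_isRegular_tfae (maximalIdeal R) (n + 1) (ModuleCat.of R M)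
    maximalIdeal_smul_top_lt_top).out 3 1).1 h
  refine ((ModuleCat.exists_isRegular_tfae (maximalIdeal R) n
    (ModuleCat.of R (QuotSMulTop z M)) maximalIdeal_smul_top_lt_top).out 1 3).1 fun i hi => ?_
  have zero1 := AddCommGrpCat.isZero_of_iff_subsingleton.mpr (h1 i (by omega))
  have zero2 := AddCommGrpCat.isZero_of_iff_subsingleton.mpr (h1 (i + 1) (by omega))
  have hreg' : IsSMulRegular (ModuleCat.of R M) z := hreg
  exact AddCommGrpCat.subsingleton_of_isZero <| ShortComplex.Exact.isZero_of_both_zeros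
    ((Abelian.Ext.covariant_sequence_exact₃' _ hreg'.smulShortComplex_shortExact) i (i + 1) rfl)
    (zero1.eq_zero_of_src _) (zero2.eq_zero_of_tgt _)

lemma supportDim_le_supportDim_quotient_ofList_add_length {R : Type*} [CommRing R] [IsLocalRing R]
    [IsNoetherianRing R] {M : Type*} [AddCommGroup M] [Module R M] [Module.Finite R M]
    (zs : List R) (hz : ∀ z ∈ zs, z ∈ maximalIdeal R) :
    supportDim R M ≤ supportDim R (M ⧸ Ideal.ofList zs • (⊤ : Submodule R M)) + zs.length := by
  induction zs generalizing M with
  | nil =>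
    rw [Ideal.ofList_nil, Submodule.bot_smul]
    simpa using (supportDim_eq_of_equiv (Submodule.quotEquivOfEqBot (⊥ : Submodule R M) rfl)).ge
  | cons z zs ih =>
    have h1 := ih (M := QuotSMulTop z M) fun r hr => hz r (List.mem_cons_of_mem z hr)
    rw [supportDim_eq_of_equiv (Submodule.quotOfListConsSMulTopEquivQuotSMulTopInner M z zs)]
    calc supportDim R M ≤ supportDim R (QuotSMulTop z M) + 1 :=
          supportDim_le_supportDim_quotSMulTop_succ (hz z List.mem_cons_self)
      _ ≤ _ := by
        rw [List.length_cons, Nat.cast_succ, ← add_assoc]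
        gcongr

/-- Systems of parameters on a Cohen-Macaulay module are regular sequences: an associated prime of
`M` has coheight at least the depth `n`, so it cannot contain a parameter. -/
theorem HasRegularSequence.isRegular_of_supportDim_le_zero {R M : Type v} [CommRing R]
    [IsLocalRing R] [IsNoetherianRing R] [AddCommGroup M] [Module R M] [Module.Finite R M]
    {zs : List R} (h : HasRegularSequence R M zs.length) (hz : ∀ z ∈ zs, z ∈ maximalIdeal R)
    (hdim : supportDim R (M ⧸ Ideal.ofList zs • (⊤ : Submodule R M)) ≤ 0) : IsRegular M zs := by
  induction zs generalizing M with
  | nil =>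
    have := h.nontrivial
    exact IsRegular.nil R M
  | cons z zs ih =>
    have hzm := hz z List.mem_cons_self
    have hzs : ∀ r ∈ zs, r ∈ maximalIdeal R := fun r hr => hz r (List.mem_cons_of_mem z hr)
    rw [supportDim_eq_of_equiv (Submodule.quotOfListConsSMulTopEquivQuotSMulTopInner M z zs)]
      at hdim
    have hreg : IsSMulRegular M z := by
      by_contra hnreg
      have : z ∈ ⋃ p ∈ associatedPrimes R M, (p : Set R) := by
        rw [biUnion_associatedPrimes_eq_compl_regular]
        exact hnreg
      obtain ⟨p, hp, hzp⟩ := Set.mem_iUnion₂.1 this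
      obtain ⟨rs, hlen, hrs, hrs'⟩ := h
      have h1 := length_le_ringKrullDim_quotient_of_mem_associatedPrimes hrs' hrs hp
      have h2 : ringKrullDim (R ⧸ p) ≤ supportDim R (QuotSMulTop z M) := by
        rw [ringKrullDim_quotient]
        refine Order.krullDim_le_of_strictMono (fun a => ⟨a.1, ?_⟩) fun {_ _} lt => lt
        have hpa : p ≤ a.1.asIdeal := a.2
        rw [Module.support_quotSMulTop]
        refine ⟨?_, ?_⟩
        · rw [Module.support_eq_zeroLocus, PrimeSpectrum.mem_zeroLocus, ← Submodule.annihilator_top]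
          exact (IsAssociatedPrime.annihilator_le hp).trans hpa
        · rw [PrimeSpectrum.mem_zeroLocus, Set.singleton_subset_iff]
          exact hpa hzp
      have h3 := supportDim_le_supportDim_quotient_ofList_add_length (M := QuotSMulTop z M) zs hzs
      have h4 : ((zs.length + 1 : ℕ) : WithBot ℕ∞) ≤ zs.length := by
        calc ((zs.length + 1 : ℕ) : WithBot ℕ∞) = (rs.length : ℕ) := by rw [hlen]; rfl
          _ ≤ _ := h1.trans (h2.trans h3)
          _ ≤ 0 + zs.length := by gcongr
          _ = zs.length := zero_add _
      have h5 : zs.length + 1 ≤ zs.length := by exact_mod_cast h4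
      omega
    exact IsRegular.cons hreg (ih (h.quotSMulTop hzm hreg) hzs hdim)

/-! ### Reduction to a Cohen-Macaulay ring of the same dimension -/

/-- Killing regular elements of the kernel one at a time, a quotient of a Cohen-Macaulay local ring
becomes a quotient of a Cohen-Macaulay local ring of the same dimension. Here a local ring `A` of
dimension `n` counts as Cohen-Macaulay when it satisfies `HasRegularSequence A A n`. -/
theorem exists_cohenMacaulay_of_ringKrullDim_eq {R : Type u} [CommRing R] [IsLocalRing R] {d : ℕ}
    (hd : ringKrullDim R = d) (n : ℕ) (A : Type v) [CommRing A] [IsLocalRing A]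
    [IsNoetherianRing A] (f : A →+* R) (hf : Function.Surjective f) (hA : ringKrullDim A = n)
    (hreg : HasRegularSequence A A n) :
    ∃ (B : Type v) (_ : CommRing B) (_ : IsLocalRing B) (_ : IsNoetherianRing B) (g : B →+* R),
      Function.Surjective g ∧ ringKrullDim B = d ∧ HasRegularSequence B B d := by
  have hle : d ≤ n := by
    have := ringKrullDim_le_of_surjective f hf
    rw [hd, hA] at this
    exact_mod_cast this
  induction n generalizing A with
  | zero =>
    obtain rfl : d = 0 := by omega
    exact ⟨A, _, ‹_›, ‹_›, f, hf, hA, hreg⟩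
  | succ n ih =>
    rcases hle.eq_or_lt with rfl | hlt
    · exact ⟨A, _, ‹_›, ‹_›, f, hf, hA, hreg⟩
    obtain ⟨z, hzf, hz⟩ : ∃ z ∈ RingHom.ker f, IsSMulRegular A z := by
      by_contra! hcon
      have hsub : (RingHom.ker f : Set A) ⊆ ⋃ p ∈ associatedPrimes A A, (id p : Ideal A) := by
        intro z hz
        have := biUnion_associatedPrimes_eq_compl_regular (R := A) A
        simp only [id]
        rw [this]
        exact hcon z hz
      obtain ⟨p, hp, hle'⟩ := (Ideal.subset_union_prime_finite (associatedPrimes.finite A A) ⊥ ⊥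
        (fun q hq _ _ => IsAssociatedPrime.isPrime hq)).1 hsub
      obtain ⟨rs, hlen, hrs, hrs'⟩ := hreg
      have h1 := length_le_ringKrullDim_quotient_of_mem_associatedPrimes hrs' hrs hp
      have h2 : ringKrullDim (A ⧸ p) ≤ ringKrullDim R := by
        rw [ringKrullDim_eq_of_ringEquiv (RingHom.quotientKerEquivOfSurjective hf).symm]
        exact ringKrullDim_quotient_le_of_le hle'
      rw [hd] at h2
      have h3 : rs.length ≤ d := by exact_mod_cast h1.trans h2
      omega
    have hzm : z ∈ maximalIdeal A := (le_maximalIdeal (RingHom.ker_ne_top f)) hzf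
    have hne : Ideal.span {z} ≠ ⊤ := fun h =>
      (maximalIdeal.isMaximal A).ne_top (top_le_iff.1 (h ▸
        (Ideal.span_singleton_le_iff_mem _).2 hzm))
    have : Nontrivial (A ⧸ Ideal.span {z}) := Ideal.Quotient.nontrivial_iff.2 hne
    have hloc : IsLocalRing (A ⧸ Ideal.span {z}) :=
      IsLocalRing.of_surjective' (Ideal.Quotient.mk _) Ideal.Quotient.mk_surjective
    have hle' : ∀ a ∈ Ideal.span {z}, f a = 0 := fun a ha =>
      ((Ideal.span_singleton_le_iff_mem (RingHom.ker f)).2 hzf) ha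
    refine ih (A ⧸ Ideal.span {z}) (Ideal.Quotient.lift _ f hle')
      (Ideal.Quotient.lift_surjective_of_surjective _ _ hf) ?_ ?_ (by omega)
    · have h1 := ringKrullDim_quotient_span_singleton_succ_eq_ringKrullDim hz hzm
      rw [hA] at h1
      have h2 : ringKrullDim (A ⧸ Ideal.span {z}) + 1 = (n : WithBot ℕ∞) + 1 := by
        rw [h1]; simp
      exact (ENat.WithBot.add_one_cancel).1 h2
    · obtain ⟨rs, hlen, hrs, hrs'⟩ := hreg.quotSMulTop hzm hz
      refine ⟨rs.map (Ideal.Quotient.mk _), by simpa using hlen, ?_, ?_⟩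
      · intro r hr
        obtain ⟨s, hs, rfl⟩ := List.mem_map.1 hr
        have : IsLocalHom (Ideal.Quotient.mk (Ideal.span {z})) :=
          Ideal.Quotient.mk_surjective.isLocalHom
        exact map_nonunit (Ideal.Quotient.mk (Ideal.span {z})) s (hrs s hs)
      · have heq : z • (⊤ : Submodule A A) = Ideal.span {z} := by
          rw [← Submodule.ideal_span_singleton_smul, smul_eq_mul, Ideal.mul_top]
        let e : QuotSMulTop z A ≃ₗ[A] (A ⧸ Ideal.span {z}) := Submodule.quotEquivOfEq _ _ heq
        refine (AddEquiv.isRegular_congr (e := e.toAddEquiv) ?_).1 hrs'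
        rw [List.forall₂_map_right_iff, List.forall₂_same]
        intro r _ x
        change e (r • x) = _
        rw [map_smul]
        rfl

/-- Prime avoidance for a coset `x + Q` and a finite antichain of primes. -/
lemma exists_add_notMem_of_isAntichain {B : Type*} [CommRing B] {S : Set (Ideal B)} (hS : S.Finite)
    (hprime : ∀ p ∈ S, p.IsPrime) (hanti : IsAntichain (· ≤ ·) S) (x : B) (Q : Ideal B)
    (h : ∀ p ∈ S, x ∈ p → ¬ Q ≤ p) : ∃ w ∈ Q, ∀ p ∈ S, x + w ∉ p := by
  classical
  let T : Finset (Ideal B) := hS.toFinset.filter fun p => x ∉ p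
  have hT : ∀ p, p ∈ T ↔ p ∈ S ∧ x ∉ p := fun p => by simp [T]
  -- a correction term that lies in the primes avoiding `x` and outside those containing `x`
  obtain ⟨w, hw, hw'⟩ : ∃ w ∈ Q ⊓ T.inf id, ∀ p ∈ S, x ∈ p → w ∉ p := by
    by_contra! hcon
    have hsub : ((Q ⊓ T.inf id : Ideal B) : Set B) ⊆
        ⋃ p ∈ {p ∈ S | x ∈ p}, ((id p : Ideal B) : Set B) := by
      intro w hw
      obtain ⟨p, hp, hxp, hwp⟩ := hcon w hw
      exact Set.mem_biUnion (show p ∈ {p ∈ S | x ∈ p} from ⟨hp, hxp⟩) hwp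
    obtain ⟨p, ⟨hp, hxp⟩, hle⟩ := (Ideal.subset_union_prime_finite
      (hS.subset (Set.sep_subset _ _)) ⊥ ⊥ (fun q hq _ _ => hprime q hq.1)).1 hsub
    rcases (hprime p hp).inf_le.1 hle with h1 | h1
    · exact h p hp hxp h1
    · obtain ⟨q, hq, hqp⟩ := (hprime p hp).inf_le'.1 h1
      obtain ⟨hqS, hxq⟩ := (hT q).1 hq
      obtain rfl := hanti.eq hqS hp hqp
      exact hxq hxp
  refine ⟨w, hw.1, fun p hp hmem => ?_⟩
  by_cases hxp : x ∈ p
  · exact hw' p hp hxp ((p.add_mem_iff_right hxp).1 hmem)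
  · have : w ∈ p := (Finset.inf_le ((hT p).2 ⟨hp, hxp⟩) : T.inf id ≤ p) hw.2
    exact hxp ((p.add_mem_iff_left this).1 hmem)

lemma ringKrullDim_le_zero_of_maximalIdeal_le_comap {B C : Type*} [CommRing B] [IsLocalRing B]
    [CommRing C] {φ : B →+* C} (hφ : Function.Surjective φ)
    (h : ∀ P : Ideal C, P.IsPrime → maximalIdeal B ≤ P.comap φ) : ringKrullDim C ≤ 0 := by
  have : Ring.KrullDimLE 0 C := by
    rw [Ring.krullDimLE_zero_iff]
    intro P hP
    have hmax : (P.comap φ).IsMaximal := by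
      rw [← (maximalIdeal.isMaximal B).eq_of_le (hP.comap φ).ne_top (h P hP)]
      infer_instance
    rw [← Ideal.map_comap_of_surjective φ hφ P]
    refine (Ideal.map_eq_top_or_isMaximal_of_surjective φ hφ hmax).resolve_left ?_
    rw [Ideal.map_comap_of_surjective φ hφ P]
    exact hP.ne_top
  exact Order.KrullDimLE.krullDim_le

section Lift

variable {B : Type v} {R : Type u} [CommRing B] [CommRing R] [IsLocalRing B] [IsLocalRing R]
  {g : B →+* R} {d : ℕ} {x : Fin d → R} {y : Fin d → B}

lemma maximalIdeal_le_of_ker_le_of_forall_mem (hg : Function.Surjective g)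
    (hx : maximalIdeal R ≤ (Ideal.span (Set.range x)).radical) (hy : ∀ i, g (y i) = x i)
    (q : Ideal B) [q.IsPrime] (hker : RingHom.ker g ≤ q) (hmem : ∀ i, y i ∈ q) :
    maximalIdeal B ≤ q := by
  intro b hb
  have hloc : IsLocalHom g := hg.isLocalHom
  have hgb : g b ∈ maximalIdeal R := map_nonunit g b hb
  obtain ⟨n, hn⟩ := hx hgb
  have hspan : Ideal.span (Set.range x) = (Ideal.span (Set.range y)).map g := by
    rw [Ideal.map_span, ← Set.range_comp]
    congr 2
    exact (funext hy).symm
  rw [hspan, ← map_pow] at hn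
  obtain ⟨a, ha, hab⟩ := (Ideal.mem_map_iff_of_surjective g hg).1 hn
  have ha' : a ∈ q := (Ideal.span_le.2 (by rintro _ ⟨i, rfl⟩; exact hmem i)) ha
  have hsub : b ^ n - a ∈ q := hker (by rw [RingHom.mem_ker, map_sub, hab, sub_self])
  exact (inferInstance : q.IsPrime).mem_of_pow_mem n ((q.sub_mem_iff_left ha').1 hsub)

lemma ringKrullDim_quotient_add_card_le [IsNoetherianRing B] (hg : Function.Surjective g)
    (hx : maximalIdeal R ≤ (Ideal.span (Set.range x)).radical) (hxm : ∀ i, x i ∈ maximalIdeal R)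
    (hy : ∀ i, g (y i) = x i) (q : Ideal B) [q.IsPrime] (hker : RingHom.ker g ≤ q)
    (s : Finset (Fin d)) (hmem : ∀ i ∈ s, y i ∈ q) :
    ringKrullDim (B ⧸ q) + s.card ≤ d := by
  classical
  have hloc : IsLocalHom g := hg.isLocalHom
  have hym : ∀ i, y i ∈ maximalIdeal B := fun i => by
    rw [← maximalIdeal_comap g, Ideal.mem_comap, hy]
    exact hxm i
  have hqloc : IsLocalRing (B ⧸ q) :=
    IsLocalRing.of_surjective' (Ideal.Quotient.mk q) Ideal.Quotient.mk_surjective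
  have hmk : IsLocalHom (Ideal.Quotient.mk q) := Ideal.Quotient.mk_surjective.isLocalHom
  let t : Finset (B ⧸ q) := sᶜ.image fun i => Ideal.Quotient.mk q (y i)
  have hzero : ringKrullDim ((B ⧸ q) ⧸ Ideal.span (t : Set (B ⧸ q))) ≤ 0 := by
    let φ : B →+* (B ⧸ q) ⧸ Ideal.span (t : Set (B ⧸ q)) :=
      (Ideal.Quotient.mk _).comp (Ideal.Quotient.mk q)
    have hφ : Function.Surjective φ := Ideal.Quotient.mk_surjective.comp
      Ideal.Quotient.mk_surjective
    have hφq : ∀ b ∈ q, φ b = 0 := fun b hb => by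
      simp [φ, Ideal.Quotient.eq_zero_iff_mem.2 hb]
    refine ringKrullDim_le_zero_of_maximalIdeal_le_comap hφ fun P hP =>
      maximalIdeal_le_of_ker_le_of_forall_mem hg hx hy (P.comap φ)
        (fun b hb => by rw [Ideal.mem_comap, hφq b (hker hb)]; exact zero_mem P) fun i => ?_
    rw [Ideal.mem_comap]
    by_cases hi : i ∈ s
    · rw [hφq _ (hmem i hi)]; exact zero_mem P
    · have : φ (y i) = 0 := Ideal.Quotient.eq_zero_iff_mem.2 (Ideal.subset_span
        (Finset.mem_coe.2 (Finset.mem_image_of_mem _ (Finset.mem_compl.2 hi))))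
      rw [this]; exact zero_mem P
  have hdim := ringKrullDim_le_ringKrullDim_quotient_add_card t (by
    rw [IsLocalRing.ringJacobson_eq_maximalIdeal]
    intro b hb
    obtain ⟨i, -, rfl⟩ := Finset.mem_image.1 (Finset.mem_coe.1 hb)
    exact map_nonunit (Ideal.Quotient.mk q) _ (hym i))
  have hcard : t.card + s.card ≤ d := by
    have h1 : t.card ≤ sᶜ.card := Finset.card_image_le
    have h2 := Finset.card_compl_add_card s
    rw [Fintype.card_fin] at h2
    omega
  calc ringKrullDim (B ⧸ q) + s.card ≤ (0 + t.card) + s.card := by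
        gcongr
        exact hdim.trans (by gcongr)
    _ = ((t.card + s.card : ℕ) : WithBot ℕ∞) := by rw [zero_add]; norm_cast
    _ ≤ d := by exact_mod_cast hcard

/-- Parameters lift to parameters along a surjection of local rings of the same dimension. Each
lift is corrected by an element of the kernel so as to avoid the minimal primes over the previous
lifts which it need not contain. -/
theorem exists_lift_parameters [IsNoetherianRing B] (hg : Function.Surjective g)
    (hd : ringKrullDim B = d) (hx : maximalIdeal R ≤ (Ideal.span (Set.range x)).radical)
    (hxm : ∀ i, x i ∈ maximalIdeal R) :
    ∃ y : Fin d → B, (∀ i, g (y i) = x i) ∧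
      maximalIdeal B ≤ (Ideal.span (Set.range y)).radical := by
  classical
  have key : ∀ s : Finset (Fin d), ∃ y : Fin d → B, (∀ i, g (y i) = x i) ∧
      ∀ q : Ideal B, q.IsPrime → (∀ i ∈ s, y i ∈ q) → ringKrullDim (B ⧸ q) + s.card ≤ d := by
    intro s
    induction s using Finset.induction_on with
    | empty =>
      choose y hy using fun i => hg (x i)
      refine ⟨y, hy, fun q _ _ => ?_⟩
      simpa [hd] using ringKrullDim_quotient_le q
    | insert a s ha ih =>
      obtain ⟨y, hy, hys⟩ := ih
      let J : Ideal B := Ideal.span (y '' s)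
      let S : Set (Ideal B) := {q ∈ J.minimalPrimes | ¬ (y a ∈ q ∧ RingHom.ker g ≤ q)}
      have hJfin : J.minimalPrimes.Finite := Ideal.finite_minimalPrimes_of_isNoetherianRing B J
      obtain ⟨w, hw, hw'⟩ := exists_add_notMem_of_isAntichain (S := S)
        (hJfin.subset (Set.sep_subset _ _)) (fun q hq => hq.1.1.1)
        (fun q hq q' hq' hne hle => hne (le_antisymm hle (hq'.1.2 hq.1.1 hle)))
        (y a) (RingHom.ker g) (fun q hq h1 h2 => hq.2 ⟨h1, h2⟩)
      have hne : ∀ i ∈ s, Function.update y a (y a + w) i = y i := fun i hi =>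
        Function.update_of_ne (fun h => ha (by rwa [← h])) _ _
      refine ⟨Function.update y a (y a + w), fun i => ?_, fun q' hq' hmem => ?_⟩
      · by_cases hi : i = a
        · subst hi
          rw [Function.update_self, map_add, hy, (RingHom.mem_ker).1 hw, add_zero]
        · rw [Function.update_of_ne hi, hy]
      have hya : y a + w ∈ q' := by
        have := hmem a (Finset.mem_insert_self a s)
        rwa [Function.update_self] at this
      have hJq' : J ≤ q' := by
        rw [Ideal.span_le]
        rintro _ ⟨i, hi, rfl⟩
        rw [← hne i hi]
        exact hmem i (Finset.mem_insert_of_mem hi)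
      obtain ⟨q, hq, hqq'⟩ := Ideal.exists_minimalPrimes_le hJq'
      have hqp : q.IsPrime := hq.1.1
      have hyq : ∀ i ∈ s, y i ∈ q := fun i hi => hq.1.2 (Ideal.subset_span ⟨i, hi, rfl⟩)
      by_cases hqS : y a ∈ q ∧ RingHom.ker g ≤ q
      · have h1 := ringKrullDim_quotient_add_card_le hg hx hxm hy q hqS.2 (insert a s)
          (fun i hi => by
            rcases Finset.mem_insert.1 hi with rfl | hi
            · exact hqS.1
            · exact hyq i hi)
        refine le_trans ?_ h1
        gcongr
        exact ringKrullDim_quotient_le_of_le hqq'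
      · have hlt : q < q' := lt_of_le_of_ne hqq' fun h => hw' q ⟨hq, hqS⟩ (h ▸ hya)
        rw [Finset.card_insert_of_notMem ha, Nat.cast_add, Nat.cast_one,
          add_comm (s.card : WithBot ℕ∞), ← add_assoc]
        refine le_trans ?_ (hys q hqp hyq)
        gcongr
        exact ringKrullDim_quotient_succ_le_of_lt hlt
  obtain ⟨y, hy, hyq⟩ := key Finset.univ
  refine ⟨y, hy, ?_⟩
  rw [Ideal.radical_eq_sInf]
  refine le_sInf fun q hq => ?_
  obtain ⟨hle, hqp⟩ := hq
  have h1 := hyq q hqp fun i _ => hle (Ideal.subset_span ⟨i, rfl⟩)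
  rw [Finset.card_univ, Fintype.card_fin] at h1
  by_contra hnot
  have hlt : q < maximalIdeal B := lt_of_le_of_ne (le_maximalIdeal hqp.ne_top) fun h => hnot h.ge
  have h2 := ringKrullDim_quotient_succ_le_of_lt hlt
  have h3 : (0 : WithBot ℕ∞) ≤ ringKrullDim (B ⧸ maximalIdeal B) :=
    ringKrullDim_nonneg_of_nontrivial
  have h4 : ((1 + d : ℕ) : WithBot ℕ∞) ≤ d := by
    calc ((1 + d : ℕ) : WithBot ℕ∞) = (0 + 1) + d := by rw [zero_add]; norm_cast
      _ ≤ (ringKrullDim (B ⧸ maximalIdeal B) + 1) + d := by gcongr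
      _ ≤ ringKrullDim (B ⧸ q) + d := by gcongr
      _ ≤ d := h1
  have h5 : 1 + d ≤ d := by exact_mod_cast h4
  omega

end Lift

/-- A surjection onto an equidimensional local ring of the same dimension pulls minimal primes back
to minimal primes. -/
lemma map_mem_minimalPrimesCompl {B : Type v} {R : Type u} [CommRing B] [CommRing R]
    {g : B →+* R} (hg : Function.Surjective g) {d : ℕ} (hB : ringKrullDim B = d)
    (hR : ringKrullDim R = d) (hequi : IsEquidimensional R) {c : B}
    (hc : c ∈ minimalPrimesCompl B) : g c ∈ minimalPrimesCompl R := by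
  intro P hP hmem
  have hPp : P.IsPrime := hP.1.1
  refine hc (P.comap g) ⟨⟨inferInstance, bot_le⟩, fun p' hp' hle => ?_⟩ hmem
  have hp'p : p'.IsPrime := hp'.1
  by_contra hnot
  have hlt : p' < P.comap g := lt_of_le_of_ne hle fun h => hnot h.ge
  have h1 := ringKrullDim_quotient_succ_le_of_lt hlt
  have h2 : ringKrullDim (R ⧸ P) ≤ ringKrullDim (B ⧸ P.comap g) :=
    ringKrullDim_le_of_surjective (Ideal.quotientMap P g le_rfl)
      (Ideal.quotientMap_surjective hg)
  rw [hequi P hP, hR] at h2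
  have h3 := ringKrullDim_quotient_le p'
  rw [hB] at h3
  have h4 : ((d + 1 : ℕ) : WithBot ℕ∞) ≤ d := by
    calc ((d + 1 : ℕ) : WithBot ℕ∞) = (d : WithBot ℕ∞) + 1 := by norm_cast
      _ ≤ ringKrullDim (B ⧸ P.comap g) + 1 := by gcongr
      _ ≤ d := h1.trans h3
  have h5 : d + 1 ≤ d := by exact_mod_cast h4
  omega

/-! ### Uniform colon killers -/

section

variable {B : Type v} [CommRing B] [IsLocalRing B] [IsNoetherianRing B]

lemma hasProjectiveDimensionLT_ofList {zs : List B} (hreg : IsRegular B zs) :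
    HasProjectiveDimensionLT (ModuleCat.of B (Ideal.ofList zs)) (zs.length + 1) := by
  have h1 := ModuleCat.projectiveDimension_quotient_eq_length.{v} zs hreg
  rw [projectiveDimension_eq_of_iso
    (Shrink.linearEquiv B (B ⧸ Ideal.ofList zs)).toModuleIso] at h1
  have h2 : HasProjectiveDimensionLT (ModuleCat.of B (B ⧸ Ideal.ofList zs)) (zs.length + 2) := by
    rw [← projectiveDimension_lt_iff, h1]
    exact_mod_cast (by omega : zs.length < zs.length + 2)
  have hS := LinearMap.shortExact_shortComplexKer (Submodule.mkQ_surjective (Ideal.ofList zs))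
  have hproj : Projective (ModuleCat.of B B) := (IsProjective.iff_projective B).1 inferInstance
  have h4 : HasProjectiveDimensionLT (ModuleCat.of B B) (zs.length + 1) :=
    hasProjectiveDimensionLT_of_ge _ 1 _ (by omega)
  have h3 := hS.hasProjectiveDimensionLT_X₁ (zs.length + 1) h4 h2
  exact @hasProjectiveDimensionLT_of_iso _ _ _ _ _
    (LinearEquiv.ofEq _ _ (Submodule.ker_mkQ (Ideal.ofList zs))).toModuleIso _ h3

lemma KillsTorOne.mul_mem {B : Type v} [CommRing B] {n : ℕ} {Q K : Ideal B} {c : B}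
    (hc : KillsTorOne B n (B ⧸ Q) c) (hK : HasProjectiveDimensionLT (ModuleCat.of B K) n) {w : B}
    (hwK : w ∈ K) (hwQ : w ∈ Q) : c * w ∈ Q * K := by
  -- `w ⊗ 1` lies in the kernel of `K ⊗ B ⧸ Q → B ⊗ B ⧸ Q`
  have h1 : c • ((⟨w, hwK⟩ : K) ⊗ₜ[B] (Ideal.Quotient.mk Q 1)) = 0 := by
    refine hc K B K.subtype (Submodule.subtype_injective K) hK _ ?_
    have : w ⊗ₜ[B] (Ideal.Quotient.mk Q 1) = (1 : B) ⊗ₜ[B] (w • (Ideal.Quotient.mk Q 1)) := by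
      rw [← TensorProduct.smul_tmul, smul_eq_mul, mul_one]
    rw [LinearMap.rTensor_tmul, Submodule.subtype_apply, this]
    have h0 : w • (Ideal.Quotient.mk Q 1) = 0 := by
      rw [Algebra.smul_def, Ideal.Quotient.algebraMap_eq, ← map_mul, mul_one]
      exact Ideal.Quotient.eq_zero_iff_mem.2 hwQ
    rw [h0, TensorProduct.tmul_zero]
  have h2 := congrArg (TensorProduct.tensorQuotEquivQuotSMul K Q) h1
  rw [map_smul, map_zero, TensorProduct.tensorQuotEquivQuotSMul_tmul_mk, one_smul,
    ← Submodule.Quotient.mk_smul, Submodule.Quotient.mk_eq_zero] at h2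
  have h3 := Submodule.mem_map_of_mem (f := K.subtype) h2
  rw [Submodule.map_smul'', Submodule.map_subtype_top, smul_eq_mul] at h3
  exact h3

/-- A system of parameters of a Cohen-Macaulay ring, enumerated so that `y i` comes last, is a
regular sequence. -/
lemma exists_isRegular_append_singleton {d : ℕ} (hreg : HasRegularSequence B B d) {y : Fin d → B}
    (hym : ∀ i, y i ∈ maximalIdeal B) (hy : maximalIdeal B ≤ (Ideal.span (Set.range y)).radical)
    (i : Fin d) : ∃ zs : List B, (zs ++ [y i]).length = d ∧
      Ideal.ofList zs = Ideal.span (y '' {i}ᶜ) ∧ IsRegular B (zs ++ [y i]) := by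
  classical
  let l : List (Fin d) := (Finset.univ.erase i).toList
  have hl : Ideal.ofList (l.map y) = Ideal.span (y '' {i}ᶜ) := by
    unfold Ideal.ofList
    congr 1
    ext b
    simp [l]
  have hlen : (l.map y ++ [y i]).length = d := by
    have : 0 < d := i.pos
    simp [l]
    omega
  have hrange : Ideal.ofList (l.map y ++ [y i]) = Ideal.span (Set.range y) := by
    rw [Ideal.ofList_append, hl, Ideal.ofList_singleton, ← Ideal.span_union, ← Set.image_singleton,
      ← Set.image_union, Set.compl_union_self, Set.image_univ]
  refine ⟨l.map y, hlen, hl,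
    HasRegularSequence.isRegular_of_supportDim_le_zero (by rwa [hlen]) ?_ ?_⟩
  · intro z hz
    rcases List.mem_append.1 hz with hz | hz
    · obtain ⟨j, -, rfl⟩ := List.mem_map.1 hz
      exact hym j
    · rw [List.mem_singleton.1 hz]
      exact hym i
  · rw [smul_eq_mul, Ideal.mul_top, supportDim_quotient_eq_ringKrullDim, hrange]
    refine ringKrullDim_le_zero_of_maximalIdeal_le_comap
      (Ideal.Quotient.mk_surjective (I := Ideal.span (Set.range y))) fun P hP => hy.trans ?_
    refine (hP.comap _).radical_le_iff.2 fun b hb => ?_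
    rw [Ideal.mem_comap, Ideal.Quotient.eq_zero_iff_mem.2 hb]
    exact zero_mem P

/-- If `u r ∈ J + Q`, write `u r = j + w` with `w ∈ Q ∩ (J + (r))`. An annihilator of `Tor₁`
multiplies `w` into `Q (J + (r))`, and `r` can be cancelled modulo `J`. -/
lemma KillsTorOne.mul_mem_sup {B : Type v} [CommRing B] {n : ℕ} {J Q : Ideal B} {c r u : B}
    (hc : KillsTorOne B n (B ⧸ Q) c)
    (hpd : HasProjectiveDimensionLT (ModuleCat.of B ↥(J ⊔ Ideal.span {r})) n)
    (hcancel : ∀ b, r * b ∈ J → b ∈ J) (hu : u * r ∈ J ⊔ Q) : c * u ∈ J ⊔ Q := by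
  obtain ⟨j, hj, w, hw, hjw⟩ := Submodule.mem_sup.1 hu
  have hwK : w ∈ J ⊔ Ideal.span {r} := by
    have : w = u * r - j := by rw [← hjw]; ring
    rw [this]
    exact sub_mem (Ideal.mem_sup_right (Ideal.mul_mem_left _ _ (Ideal.mem_span_singleton_self _)))
      (Ideal.mem_sup_left hj)
  have hcw := hc.mul_mem hpd hwK hw
  rw [Ideal.mul_sup] at hcw
  obtain ⟨j', hj', w', hw', hjw'⟩ := Submodule.mem_sup.1 hcw
  obtain ⟨v, hv, rfl⟩ := Ideal.mem_mul_span_singleton.1 hw'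
  have hj'' : j' ∈ J := Ideal.mul_le_right hj'
  have hfin : c * u - v ∈ J := by
    apply hcancel
    have : r * (c * u - v) = c * j + j' := by
      linear_combination (-c) * hjw - hjw'
    rw [this]
    exact add_mem (Ideal.mul_mem_left _ _ hj) hj''
  have : c * u = (c * u - v) + v := by ring
  rw [this]
  exact add_mem (Ideal.mem_sup_left hfin) (Ideal.mem_sup_right hv)

theorem exists_colon_killer_cohenMacaulay {d : ℕ} (hreg : HasRegularSequence B B d) (Q : Ideal B) :
    ∃ c ∈ minimalPrimesCompl B, ∀ y : Fin d → B, (∀ i, y i ∈ maximalIdeal B) →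
      maximalIdeal B ≤ (Ideal.span (Set.range y)).radical → ∀ (i : Fin d) (u : B),
      u * y i ∈ Ideal.span (y '' {i}ᶜ) ⊔ Q → c * u ∈ Ideal.span (y '' {i}ᶜ) ⊔ Q := by
  obtain ⟨c, hc, hkill⟩ := exists_killsTorOne B (d + 1) (B ⧸ Q)
  refine ⟨c, hc, fun y hym hy i u hu => ?_⟩
  obtain ⟨zs, hlen, hzsJ, hzs⟩ := exists_isRegular_append_singleton hreg hym hy i
  have hpd := hasProjectiveDimensionLT_ofList hzs
  rw [hlen, Ideal.ofList_append, Ideal.ofList_singleton, hzsJ] at hpd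
  refine hkill.mul_mem_sup hpd (fun b hb => ?_) hu
  have h1 := ((isWeaklyRegular_append_iff B _ _).1 hzs.toIsWeaklyRegular).2
  rw [isWeaklyRegular_singleton_iff, smul_eq_mul, Ideal.mul_top, hzsJ] at h1
  have h2 : y i • (Ideal.Quotient.mk (Ideal.span (y '' {i}ᶜ)) b) = 0 := by
    rw [Algebra.smul_def, Ideal.Quotient.algebraMap_eq, ← map_mul]
    exact Ideal.Quotient.eq_zero_iff_mem.2 hb
  rw [← smul_zero (y i)] at h2
  exact Ideal.Quotient.eq_zero_iff_mem.1 (h1 h2)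

end

lemma IsCohenMacaulayRing.exists_hasRegularSequence {A : Type v} [CommRing A]
    (hA : IsCohenMacaulayRing A) (P : Ideal A) [P.IsMaximal] :
    ∃ n : ℕ, ringKrullDim (Localization.AtPrime P) = n ∧
      HasRegularSequence (Localization.AtPrime P) (Localization.AtPrime P) n := by
  have := hA.isNoetherianRing
  have : IsNoetherianRing (Localization.AtPrime P) :=
    IsLocalization.isNoetherianRing P.primeCompl _ inferInstance
  obtain ⟨n, hn⟩ : ∃ n : ℕ, ringKrullDim (Localization.AtPrime P) = n := by
    obtain ⟨n, hn⟩ := ENat.ne_top_iff_exists.1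
      (Ideal.height_ne_top_of_isPrime (I := maximalIdeal (Localization.AtPrime P)))
    exact ⟨n, by rw [← maximalIdeal_height_eq_ringKrullDim, ← hn]; rfl⟩
  refine ⟨n, hn, ?_⟩
  have h := hA.depth_eq_dim P
  rw [hn] at h
  have h' : localDepth (Localization.AtPrime P) = n := by exact_mod_cast h
  rcases Nat.eq_zero_or_pos n with rfl | hpos
  · exact ⟨[], rfl, by simp, IsRegular.nil _ _⟩
  -- a supremum equal to a positive natural number is attained
  have hlt : ((n - 1 : ℕ) : ℕ∞) < localDepth (Localization.AtPrime P) := by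
    rw [h']
    exact_mod_cast (by omega : n - 1 < n)
  unfold localDepth at hlt h'
  obtain ⟨rs, hlt⟩ := lt_iSup_iff.1 hlt
  obtain ⟨hrs, hlt⟩ := lt_iSup_iff.1 hlt
  obtain ⟨hrs', hlt⟩ := lt_iSup_iff.1 hlt
  have hle : (rs.length : ℕ∞) ≤ n := by
    rw [← h']
    exact le_iSup_of_le rs (le_iSup_of_le hrs (le_iSup_of_le hrs' le_rfl))
  have h1 : n - 1 < rs.length := by exact_mod_cast hlt
  have h2 : rs.length ≤ n := by exact_mod_cast hle
  exact ⟨rs, by omega, hrs, hrs'⟩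

lemma exists_local_cohenMacaulay {A : Type v} [CommRing A]
    (hA : IsCohenMacaulayRing A) {R : Type u} [CommRing R] [IsLocalRing R] (f : A →+* R)
    (hf : Function.Surjective f) :
    ∃ (B : Type v) (_ : CommRing B) (_ : IsLocalRing B) (_ : IsNoetherianRing B) (g : B →+* R)
      (n : ℕ), Function.Surjective g ∧ ringKrullDim B = n ∧ HasRegularSequence B B n := by
  have := hA.isNoetherianRing
  let P : Ideal A := (maximalIdeal R).comap f
  have : P.IsMaximal := Ideal.comap_isMaximal_of_surjective f hf
  obtain ⟨n, hn, hreg⟩ := hA.exists_hasRegularSequence P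
  have hunit : ∀ a : P.primeCompl, IsUnit (f a) := fun a => by
    have := a.2
    by_contra h
    exact this h
  refine ⟨Localization.AtPrime P, inferInstance, inferInstance,
    IsLocalization.isNoetherianRing P.primeCompl _ inferInstance,
    IsLocalization.lift hunit, n, fun r => ?_, hn, hreg⟩
  obtain ⟨a, rfl⟩ := hf r
  exact ⟨algebraMap _ _ a, IsLocalization.lift_eq hunit a⟩

/-- In an equidimensional quotient of a Cohen-Macaulay ring, one element outside all minimal primes
multiplies `(x_j^{t_j} : j ≠ i) : x_i^{t_i}` into `(x_j^{t_j} : j ≠ i)`, for all positive exponents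
at once. -/
theorem exists_colon_killer {R : Type u} [CommRing R] [IsLocalRing R] (hequi : IsEquidimensional R)
    {A : Type v} [CommRing A] (hA : IsCohenMacaulayRing A) (f : A →+* R)
    (hf : Function.Surjective f) {d : ℕ} (hd : ringKrullDim R = d) (x : Fin d → R)
    (hx : (Ideal.span (Set.range x)).radical = maximalIdeal R) :
    ∃ c ∈ minimalPrimesCompl R, ∀ t : Fin d → ℕ, (∀ i, t i ≠ 0) → ∀ (i : Fin d) (u : R),
      u * x i ^ t i ∈ Ideal.span ((fun j => x j ^ t j) '' {i}ᶜ) →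
      c * u ∈ Ideal.span ((fun j => x j ^ t j) '' {i}ᶜ) := by
  obtain ⟨A', _, _, _, f', n, hf', hn, hreg'⟩ := exists_local_cohenMacaulay hA f hf
  obtain ⟨B, _, _, _, g, hg, hB, hreg⟩ :=
    exists_cohenMacaulay_of_ringKrullDim_eq hd n A' f' hf' hn hreg'
  have hxm : ∀ i, x i ∈ maximalIdeal R := fun i =>
    hx ▸ Ideal.le_radical (Ideal.subset_span ⟨i, rfl⟩)
  obtain ⟨y, hy, hyrad⟩ := exists_lift_parameters hg hB hx.ge hxm
  have hloc : IsLocalHom g := hg.isLocalHom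
  have hym : ∀ i, y i ∈ maximalIdeal B := fun i => by
    rw [← maximalIdeal_comap g, Ideal.mem_comap, hy]
    exact hxm i
  obtain ⟨c, hc, hkill⟩ := exists_colon_killer_cohenMacaulay hreg (RingHom.ker g)
  refine ⟨g c, map_mem_minimalPrimesCompl hg hB hd hequi hc, fun t ht i u hu => ?_⟩
  have hspan : Ideal.span ((fun j => x j ^ t j) '' {i}ᶜ) =
      (Ideal.span ((fun j => y j ^ t j) '' {i}ᶜ)).map g := by
    rw [Ideal.map_span, Set.image_image]
    simp only [map_pow, hy]
  have hcomap : ∀ b : B, g b ∈ Ideal.span ((fun j => x j ^ t j) '' {i}ᶜ) ↔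
      b ∈ Ideal.span ((fun j => y j ^ t j) '' {i}ᶜ) ⊔ RingHom.ker g := fun b => by
    rw [hspan, ← Ideal.mem_comap, Ideal.comap_map_of_surjective' g hg]
  obtain ⟨v, rfl⟩ := hg u
  rw [← map_mul, hcomap]
  refine hkill (fun j => y j ^ t j) (fun j => Ideal.pow_mem_of_mem _ (hym j) _ (ht j).bot_lt)
    (hyrad.trans ?_) i v ?_
  · refine Ideal.radical_le_radical_iff.2 (Ideal.span_le.2 ?_)
    rintro _ ⟨j, rfl⟩
    exact ⟨t j, Ideal.subset_span ⟨j, rfl⟩⟩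
  · rw [← hcomap, map_mul, map_pow, hy]
    exact hu

/-! ### Tight closure and monomial filtrations -/

section

variable {R : Type*} [CommRing R]

/-- The successive quotients of the filtration of `R ⧸ L` by the ideals generated by `L` and the
`z b` with `b > a` are cyclic; if each of them maps onto `R ⧸ K`, the lengths add up. -/
lemma card_mul_length_quotient_le {ι : Type*} [LinearOrder ι] [Fintype ι] (z : ι → R)
    (K L : Ideal R)
    (h : ∀ (a : ι) (r : R), r * z a ∈ L ⊔ Ideal.span (z '' Set.Ioi a) → r ∈ K) :
    (Fintype.card ι : ℕ∞) * Module.length R (R ⧸ K) ≤ Module.length R (R ⧸ L) := by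
  classical
  have key : ∀ s : Finset ι, (s.card : ℕ∞) * Module.length R (R ⧸ K) +
      Module.length R (R ⧸ (L ⊔ Ideal.span (z '' s))) ≤ Module.length R (R ⧸ L) := by
    intro s
    induction s using Finset.induction_on_min with
    | empty =>
      rw [Finset.card_empty, Nat.cast_zero, zero_mul, zero_add, Finset.coe_empty, Set.image_empty,
        Ideal.span_empty, sup_bot_eq]
    | insert a s has ih =>
      refine le_trans ?_ ih
      have hnot : a ∉ s := fun h => lt_irrefl a (has a h)
      let ψ : R →ₗ[R] R ⧸ (L ⊔ Ideal.span (z '' s)) :=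
        (Submodule.mkQ _).comp (LinearMap.toSpanSingleton R R (z a))
      have hψ : ∀ r, ψ r = 0 ↔ r * z a ∈ L ⊔ Ideal.span (z '' s) := fun r => by
        simp only [ψ, LinearMap.comp_apply, LinearMap.toSpanSingleton_apply, Submodule.mkQ_apply,
          Submodule.Quotient.mk_eq_zero, smul_eq_mul]
      have hker : LinearMap.ker ψ ≤ K := fun r hr => h a r <| by
        have hr' := (hψ r).1 hr
        exact sup_le_sup_left (Ideal.span_mono (Set.image_mono fun b hb => has b hb)) L hr'
      have hle : L ⊔ Ideal.span (z '' s) ≤ L ⊔ Ideal.span (z '' (insert a s : Finset ι)) :=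
        sup_le_sup_left (Ideal.span_mono (Set.image_mono (by simp))) L
      have hrange : LinearMap.range ψ ≤ LinearMap.ker (Submodule.factor hle) := by
        rintro _ ⟨r, rfl⟩
        rw [LinearMap.mem_ker]
        simp only [ψ, LinearMap.comp_apply, LinearMap.toSpanSingleton_apply, Submodule.mkQ_apply,
          smul_eq_mul]
        refine (Submodule.Quotient.mk_eq_zero _).2 ?_
        exact Ideal.mul_mem_left _ _ (Ideal.mem_sup_right (Ideal.subset_span ⟨a, by simp, rfl⟩))
      have h1 : Module.length R (R ⧸ K) ≤ Module.length R (LinearMap.range ψ) := by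
        rw [← (ψ.quotKerEquivRange).length_eq]
        exact Module.length_le_of_surjective (Submodule.factor hker)
          (Submodule.factor_surjective hker)
      have h2 : Module.length R (R ⧸ (L ⊔ Ideal.span (z '' (insert a s : Finset ι)))) ≤
          Module.length R ((R ⧸ (L ⊔ Ideal.span (z '' s))) ⧸ LinearMap.range ψ) :=
        Module.length_le_of_surjective
          (Submodule.liftQ (LinearMap.range ψ) (Submodule.factor hle) hrange) (by
            rw [← LinearMap.range_eq_top, Submodule.range_liftQ, LinearMap.range_eq_top]
            exact Submodule.factor_surjective hle)
      have h3 := Module.length_eq_add_of_exact (LinearMap.range ψ).subtype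
        (LinearMap.range ψ).mkQ (Submodule.subtype_injective _) (Submodule.mkQ_surjective _)
        (LinearMap.exact_subtype_mkQ _)
      rw [h3, Finset.card_insert_of_notMem hnot, Nat.cast_succ, add_mul, one_mul, add_assoc]
      gcongr
  have h1 := key Finset.univ
  rw [Finset.card_univ] at h1
  exact le_self_add.trans h1

variable {d : ℕ} {x : Fin d → R} {c : R}

lemma colon_killer_step {a : Fin d} {t : Fin d → ℕ} (ht : ∀ i, t i ≠ 0)
    (hc : ∀ t : Fin d → ℕ, (∀ i, t i ≠ 0) → ∀ (i : Fin d) (u : R),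
      u * x i ^ t i ∈ Ideal.span ((fun j => x j ^ t j) '' {i}ᶜ) →
      c * u ∈ Ideal.span ((fun j => x j ^ t j) '' {i}ᶜ)) (n : ℕ) (w : R)
    (hw : w * x a ^ n ∈
      Ideal.span (Set.range fun j => x j ^ Function.update t a (t a + n) j)) :
    c * w ∈ Ideal.span (Set.range fun j => x j ^ t j) := by
  rcases Nat.eq_zero_or_pos n with rfl | hn
  · rw [add_zero, Function.update_eq_self, pow_zero, mul_one] at hw
    exact Ideal.mul_mem_left _ _ hw
  have himage : ∀ k, (fun j => x j ^ Function.update t a k j) '' {a}ᶜ =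
      (fun j => x j ^ t j) '' {a}ᶜ := fun k => Set.image_congr fun j hj => by
    rw [Function.update_of_ne hj]
  have hrange : ∀ y : Fin d → R, Ideal.span (Set.range y) =
      Ideal.span (y '' {a}ᶜ) ⊔ Ideal.span {y a} := fun y => by
    rw [← Ideal.span_union, ← Set.image_singleton, ← Set.image_union, Set.compl_union_self,
      Set.image_univ]
  rw [hrange, himage, Function.update_self] at hw
  obtain ⟨j, hj, v, hv, hjv⟩ := Submodule.mem_sup.1 hw
  obtain ⟨b, rfl⟩ := Ideal.mem_span_singleton'.1 hv
  have h1 := hc (Function.update t a n) (fun i => by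
    by_cases hi : i = a
    · subst hi; rw [Function.update_self]; omega
    · rw [Function.update_of_ne hi]; exact ht i) a (w - b * x a ^ t a) (by
      rw [himage, Function.update_self]
      have : (w - b * x a ^ t a) * x a ^ n = j := by
        rw [pow_add] at hjv
        linear_combination -hjv
      rwa [this])
  rw [himage] at h1
  rw [hrange]
  have : c * w = c * (w - b * x a ^ t a) + c * b * x a ^ t a := by ring
  rw [this]
  exact add_mem (Ideal.mem_sup_left h1)
    (Ideal.mem_sup_right (Ideal.mul_mem_left _ _ (Ideal.mem_span_singleton_self _)))

/-- Treating the variables one at a time, a colon killer `c` yields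
`c ^ d * ((x^{t + n}) : x^n) ⊆ (x^t)`. -/
lemma pow_mul_mem_of_mul_prod_mem
    (hc : ∀ t : Fin d → ℕ, (∀ i, t i ≠ 0) → ∀ (i : Fin d) (u : R),
      u * x i ^ t i ∈ Ideal.span ((fun j => x j ^ t j) '' {i}ᶜ) →
      c * u ∈ Ideal.span ((fun j => x j ^ t j) '' {i}ᶜ)) (n t : Fin d → ℕ) (ht : ∀ i, t i ≠ 0)
    (u : R) (hu : u * ∏ i, x i ^ n i ∈ Ideal.span (Set.range fun i => x i ^ (t i + n i))) :
    c ^ d * u ∈ Ideal.span (Set.range fun i => x i ^ t i) := by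
  classical
  have key : ∀ (s : Finset (Fin d)) (t : Fin d → ℕ), (∀ i, t i ≠ 0) → ∀ u : R,
      u * ∏ i ∈ s, x i ^ n i ∈
        Ideal.span (Set.range fun i => x i ^ (t i + if i ∈ s then n i else 0)) →
      c ^ s.card * u ∈ Ideal.span (Set.range fun i => x i ^ t i) := by
    intro s
    induction s using Finset.induction_on with
    | empty =>
      intro t ht u hu
      simpa using hu
    | insert a s ha ih =>
      intro t ht u hu
      rw [Finset.card_insert_of_notMem ha, pow_succ', mul_assoc]
      refine colon_killer_step (a := a) ht hc (n a) _ ?_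
      rw [mul_assoc]
      refine ih _ (fun i => ?_) _ ?_
      · by_cases hi : i = a
        · subst hi; rw [Function.update_self]; have := ht i; omega
        · rw [Function.update_of_ne hi]; exact ht i
      · rw [Finset.prod_insert ha, ← mul_assoc] at hu
        convert hu using 5 with i
        by_cases hi : i = a
        · subst hi; simp [ha]
        · simp [hi]
  have := key Finset.univ t ht u (by simpa using hu)
  simpa using this

end

section CharP

variable {R : Type*} [CommRing R] (p : ℕ) [Fact p.Prime] [CharP R p]

lemma frobeniusPower_eq_map (I : Ideal R) (e : ℕ) :
    frobeniusPower I (p ^ e) = I.map (iterateFrobenius R p e) := by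
  unfold frobeniusPower Ideal.map
  congr 1
  ext y
  simp only [Set.mem_ofPred_eq, Set.mem_image, SetLike.mem_coe, iterateFrobenius_def]
  exact ⟨fun ⟨i, hi, h⟩ => ⟨i, hi, h.symm⟩, fun ⟨i, hi, h⟩ => ⟨i, hi, h.symm⟩⟩

lemma frobeniusPower_span_range {ι : Type*} (x : ι → R) (e : ℕ) :
    frobeniusPower (Ideal.span (Set.range x)) (p ^ e) =
      Ideal.span (Set.range fun i => x i ^ p ^ e) := by
  rw [frobeniusPower_eq_map, Ideal.map_span, ← Set.range_comp]
  rfl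

lemma frobeniusPower_frobeniusPower (I : Ideal R) (e e' : ℕ) :
    frobeniusPower (frobeniusPower I (p ^ e)) (p ^ e') = frobeniusPower I (p ^ (e + e')) := by
  rw [frobeniusPower_eq_map, frobeniusPower_eq_map, frobeniusPower_eq_map, Ideal.map_map]
  congr 1
  ext y
  simp [iterateFrobenius_def, pow_add, pow_mul]

lemma le_tightClosure (I : Ideal R) : I ≤ tightClosure p I := fun x hx =>
  ⟨1, one_mem_minimalPrimesCompl R, 0, fun e _ => by
    rw [one_mul]
    exact Ideal.subset_span ⟨x, hx, rfl⟩⟩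

variable {p} {d : ℕ} {x : Fin d → R} {c : R}

/-- If `r x^a` lies in the tight closure of `(x_1^p, …, x_d^p)` up to an element of the ideal
`(x_1^{a_1 + 1}, …, x_d^{a_d + 1})`, then `r` lies in the tight closure of `(x_1, …, x_d)`. -/
lemma mem_tightClosure_of_mul_prod_mem (hc0 : c ∈ minimalPrimesCompl R)
    (hc : ∀ t : Fin d → ℕ, (∀ i, t i ≠ 0) → ∀ (i : Fin d) (u : R),
      u * x i ^ t i ∈ Ideal.span ((fun j => x j ^ t j) '' {i}ᶜ) →
      c * u ∈ Ideal.span ((fun j => x j ^ t j) '' {i}ᶜ)) {a : Fin d → ℕ} (ha : ∀ i, a i < p) {r : R}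
    (hr : r * ∏ i, x i ^ a i ∈ tightClosure p (frobeniusPower (Ideal.span (Set.range x)) p) ⊔
      Ideal.span (Set.range fun i => x i ^ (a i + 1))) :
    r ∈ tightClosure p (Ideal.span (Set.range x)) := by
  obtain ⟨g, ⟨c', hc', N, hg⟩, h, hh, hgh⟩ := Submodule.mem_sup.1 hr
  refine ⟨c ^ d * c', mul_mem_minimalPrimesCompl (pow_mem_minimalPrimesCompl hc0 d) hc', N,
    fun e he => ?_⟩
  have hp : p ^ e ≠ 0 := pow_ne_zero _ (Fact.out : p.Prime).ne_zero
  rw [frobeniusPower_span_range, mul_assoc]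
  refine pow_mul_mem_of_mul_prod_mem hc (fun i => a i * p ^ e) (fun _ => p ^ e) (fun _ => hp) _ ?_
  have h1 : c' * g ^ p ^ e ∈ Ideal.span (Set.range fun i => x i ^ (p ^ e + a i * p ^ e)) := by
    have h0 := hg e he
    have h2 := frobeniusPower_frobeniusPower p (Ideal.span (Set.range x)) 1 e
    rw [pow_one] at h2
    rw [h2, frobeniusPower_span_range] at h0
    refine (Ideal.span_le.2 ?_) h0
    rintro _ ⟨i, rfl⟩
    have h3 : p ^ e + a i * p ^ e ≤ p ^ (1 + e) := by
      calc p ^ e + a i * p ^ e = (a i + 1) * p ^ e := by ring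
        _ ≤ p * p ^ e := Nat.mul_le_mul_right _ (ha i)
        _ = p ^ (1 + e) := by ring
    exact Ideal.mem_of_dvd _ (pow_dvd_pow _ h3) (Ideal.subset_span ⟨i, rfl⟩)
  have h2 : h ^ p ^ e ∈ Ideal.span (Set.range fun i => x i ^ (p ^ e + a i * p ^ e)) := by
    have h0 : h ^ p ^ e ∈ frobeniusPower (Ideal.span (Set.range fun i => x i ^ (a i + 1)))
      (p ^ e) := Ideal.subset_span ⟨h, hh, rfl⟩
    rw [frobeniusPower_span_range] at h0
    convert h0 using 4 with i
    rw [← pow_mul]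
    congr 1
    ring
  have h3 : c' * r ^ p ^ e * ∏ i, x i ^ (a i * p ^ e) = c' * g ^ p ^ e + c' * h ^ p ^ e := by
    rw [← mul_add, ← add_pow_char_pow, hgh, mul_pow, ← Finset.prod_pow]
    simp only [pow_mul]
    ring
  rw [h3]
  exact add_mem h1 (Ideal.mul_mem_left _ _ h2)

/-- The monomials `x^a` with exponents below `p`, ordered lexicographically, cut `R ⧸ (I^{[p]})^*`
into `p ^ d` pieces, each mapping onto `R ⧸ I^*`. -/
theorem pow_mul_length_quotient_tightClosure_le (hc0 : c ∈ minimalPrimesCompl R)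
    (hc : ∀ t : Fin d → ℕ, (∀ i, t i ≠ 0) → ∀ (i : Fin d) (u : R),
      u * x i ^ t i ∈ Ideal.span ((fun j => x j ^ t j) '' {i}ᶜ) →
      c * u ∈ Ideal.span ((fun j => x j ^ t j) '' {i}ᶜ)) :
    (p : ℕ∞) ^ d * Module.length R (R ⧸ tightClosure p (Ideal.span (Set.range x))) ≤
      Module.length R
        (R ⧸ tightClosure p (frobeniusPower (Ideal.span (Set.range x)) p)) := by
  have hcard : Fintype.card (Lex (Fin d → Fin p)) = p ^ d := by
    rw [Fintype.card_lex]; simp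
  have h := card_mul_length_quotient_le (ι := Lex (Fin d → Fin p))
    (fun a => ∏ i, x i ^ (ofLex a i : ℕ)) (tightClosure p (Ideal.span (Set.range x)))
    (tightClosure p (frobeniusPower (Ideal.span (Set.range x)) p)) fun a r hr => ?_
  · rw [hcard] at h
    exact_mod_cast h
  · refine mem_tightClosure_of_mul_prod_mem hc0 hc (a := fun i => (ofLex a i : ℕ))
      (fun i => (ofLex a i).2) ?_
    refine (sup_le_sup_left ?_ (tightClosure p (frobeniusPower (Ideal.span (Set.range x)) p)) :
      _ ≤ _) hr
    rw [Ideal.span_le]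
    rintro _ ⟨b, hb, rfl⟩
    -- a lexicographically larger monomial exceeds `x^a` in some exponent
    have hnle : ¬ ofLex b ≤ ofLex a := fun h => not_lt_of_ge (Pi.toLex_monotone h) hb
    obtain ⟨i, hi⟩ := not_forall.1 hnle
    have hlt : (ofLex a i : ℕ) + 1 ≤ (ofLex b i : ℕ) := not_le.1 hi
    exact Ideal.mem_of_dvd _ ((pow_dvd_pow _ hlt).trans (Finset.dvd_prod_of_mem _
      (Finset.mem_univ i))) (Ideal.subset_span ⟨i, rfl⟩)

end CharP

lemma length_quotient_ne_top_of_maximalIdeal_le_radical {R : Type*} [CommRing R] [IsLocalRing R]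
    [IsNoetherianRing R] {J : Ideal R} (hJ : maximalIdeal R ≤ J.radical) :
    Module.length R (R ⧸ J) ≠ ⊤ := by
  have h0 : ringKrullDim (R ⧸ J) ≤ 0 := by
    refine ringKrullDim_le_zero_of_maximalIdeal_le_comap
      (Ideal.Quotient.mk_surjective (I := J)) fun P hP => hJ.trans ?_
    refine (hP.comap _).radical_le_iff.2 fun b hb => ?_
    rw [Ideal.mem_comap, Ideal.Quotient.eq_zero_iff_mem.2 hb]
    exact zero_mem P
  have : Ring.KrullDimLE 0 (R ⧸ J) := (Order.krullDimLE_iff _ _).2 h0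
  have hart : IsArtinianRing (R ⧸ J) :=
    isArtinianRing_iff_isNoetherianRing_krullDimLE_zero.2 ⟨inferInstance, this⟩
  have : IsArtinian R (R ⧸ J) :=
    isArtinian_of_surjective_algebraMap (S := R) (R := R ⧸ J) Ideal.Quotient.mk_surjective
  rw [Module.length_ne_top_iff, isFiniteLength_iff_isNoetherian_isArtinian]
  exact ⟨inferInstance, this⟩

end TightClosureIneq

theorem mainTheorem5 {R : Type*} [CommRing R] [IsLocalRing R] [IsNoetherianRing R]
    (p : ℕ) [Fact p.Prime] [CharP R p]
    (hequi : TightClosureIneq.IsEquidimensional R)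
    {A : Type*} [CommRing A] (hA : TightClosureIneq.IsCohenMacaulayRing A)
    (f : A →+* R) (hf : Function.Surjective f)
    (d : ℕ) (hd : ringKrullDim R = d)
    (I : Ideal R) (hI : TightClosureIneq.IsParameterIdeal I) :
    ((p : ℕ∞) ^ d * Module.length R (R ⧸ TightClosureIneq.tightClosure p I) ≤
      Module.length R
        (R ⧸ TightClosureIneq.tightClosure p (TightClosureIneq.frobeniusPower I p))) ∧
    (∀ e : ℕ, Module.length R
      (R ⧸ TightClosureIneq.tightClosure p (TightClosureIneq.frobeniusPower I (p ^ e))) ≠ ⊤) ∧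
    Monotone (fun e : ℕ =>
      ((Module.length R
        (R ⧸ TightClosureIneq.tightClosure p
          (TightClosureIneq.frobeniusPower I (p ^ e)))).toNat : ℝ) / ((p : ℝ) ^ e) ^ d) := by
  obtain ⟨d', x, hd', rfl, hrad⟩ := hI
  obtain rfl : d' = d := by
    rw [hd] at hd'
    exact_mod_cast hd'.symm
  have hp : p.Prime := Fact.out
  have hradpow : ∀ e : ℕ, (Ideal.span (Set.range fun i => x i ^ p ^ e)).radical =
      IsLocalRing.maximalIdeal R := fun e => by
    refine le_antisymm ?_ ?_
    · rw [← hrad]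
      refine Ideal.radical_mono (Ideal.span_le.2 ?_)
      rintro _ ⟨i, rfl⟩
      exact Ideal.pow_mem_of_mem _ (Ideal.subset_span (Set.mem_range_self i)) _ (pow_pos hp.pos e)
    · rw [← hrad]
      refine Ideal.radical_le_radical_iff.2 (Ideal.span_le.2 ?_)
      rintro _ ⟨i, rfl⟩
      exact Ideal.mem_radical_iff.2 ⟨p ^ e, Ideal.subset_span (Set.mem_range_self i)⟩
  have hmain : ∀ y : Fin d' → R,
      (Ideal.span (Set.range y)).radical = IsLocalRing.maximalIdeal R →
      (p : ℕ∞) ^ d' * Module.length R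
          (R ⧸ TightClosureIneq.tightClosure p (Ideal.span (Set.range y))) ≤
        Module.length R (R ⧸ TightClosureIneq.tightClosure p
          (TightClosureIneq.frobeniusPower (Ideal.span (Set.range y)) p)) := fun y hy => by
    obtain ⟨c, hc0, hc⟩ := TightClosureIneq.exists_colon_killer hequi hA f hf hd y hy
    exact TightClosureIneq.pow_mul_length_quotient_tightClosure_le hc0 hc
  have hfin : ∀ e : ℕ, Module.length R (R ⧸ TightClosureIneq.tightClosure p
      (TightClosureIneq.frobeniusPower (Ideal.span (Set.range x)) (p ^ e))) ≠ ⊤ := fun e => by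
    refine TightClosureIneq.length_quotient_ne_top_of_maximalIdeal_le_radical ?_
    rw [TightClosureIneq.frobeniusPower_span_range, ← hradpow e]
    exact Ideal.radical_mono (TightClosureIneq.le_tightClosure p _)
  refine ⟨hmain x hrad, hfin, monotone_nat_of_le_succ fun e => ?_⟩
  have h1 := hmain _ (hradpow e)
  have h2 := TightClosureIneq.frobeniusPower_frobeniusPower p (Ideal.span (Set.range x)) e 1
  rw [pow_one] at h2
  rw [← TightClosureIneq.frobeniusPower_span_range, h2] at h1
  have h3 := ENat.toNat_le_toNat h1 (hfin (e + 1))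
  rw [ENat.toNat_mul, ← Nat.cast_pow, ENat.toNat_natCast] at h3
  have hp0 : (0 : ℝ) < p := by exact_mod_cast hp.pos
  rw [div_le_div_iff₀ (by positivity) (by positivity), pow_succ, mul_pow]
  have h4 : (p : ℝ) ^ d' * ((Module.length R (R ⧸ TightClosureIneq.tightClosure p
      (TightClosureIneq.frobeniusPower (Ideal.span (Set.range x)) (p ^ e)))).toNat : ℝ) ≤
      ((Module.length R (R ⧸ TightClosureIneq.tightClosure p
      (TightClosureIneq.frobeniusPower (Ideal.span (Set.range x)) (p ^ (e + 1))))).toNat : ℝ) := by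
    exact_mod_cast h3
  calc _ = ((p : ℝ) ^ d' * ((Module.length R (R ⧸ TightClosureIneq.tightClosure p
      (TightClosureIneq.frobeniusPower (Ideal.span (Set.range x)) (p ^ e)))).toNat : ℝ)) *
        ((p : ℝ) ^ e) ^ d' := by ring
    _ ≤ _ := mul_le_mul_of_nonneg_right h4 (by positivity)
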